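/- Fix $n\ge 0$ and processes (colors) $0,\dots,n$. **Complexes.** A chromatic complex is a simplicial complex with a coloring $\chi$ of its vertices by $0,\dots,n$ that is injective on each simplex. A chromatic map is a color-preserving simplicial map. The standard chromatic subdivision $\operatorname{Chr} C$ of a chromatic complex $C$ has as vertices the pairs $(p,t)$ with $t$ a simplex of $C$ and $p\in t$, colored by $\chi(p)$; its simplices are the nonempty subsets of the sets $\{(p,t_p) : p\in\sigma\}$, where $\sigma$ is a simplex of $C$, $p\in t_p\subseteq\sigma$, any two $t_p,t_q$ are comparable under inclusion, and $q\in t_p$ implies $t_q\subseteq t_p$. $\operatorname{Chr}^k$ is its $k$-fold iterate ($\operatorname{Chr}^0C=C$). For a simplex $\tau$ of $C$, viewed as the subcomplex of its faces, $\operatorname{Chr}^k\tau$ is a subcomplex of $\operatorname{Chr}^kC$. **Tasks.** A task $T=(\mathcal I,\mathcal O,\Delta)$ consists of two finite chromatic complexes $\mathcal I,\mathcal O$, pure of dimension $n$, and a map $\Delta$ that assigns to each simplex $\sigma$ of $\mathcal I$ a subcomplex $\Delta(\sigma)$ of $\mathcal O$, pure of dimension $\dim\sigma$ and possibly empty, such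 that $\chi(\Delta(\sigma))=\chi(\sigma)$ whenever $\Delta(\sigma)\neq\emptyset$, and $\Delta(\sigma\cap\tau)\subseteq\Delta(\sigma)\cap\Delta(\tau)$ whenever $\sigma\cap\tau\ne\emptyset$. **Runs and views.** A run is a sequence $S_1\supseteq S_2\supseteq\cdots$ of nonempty sets of processes, each with an ordered partition $S_k=S_k^1\cup\dots\cup S_k^{n_k}$ into nonempty blocks; $\mathit{part}(r)=S_1$. Let $\omega$ be an $n$-simplex of $\mathcal I$. Process $i$ has a $k$th view when $k=0$ or $i\in S_k$. Its $0$th view $\mathit{view}(i,\omega,0)$ is the pair $(i,v)$ with $v$ the vertex of $\omega$ colored $i$; for $k\ge1$ and $i\in S_k^j$, its $k$th view $\mathit{view}(i,\omega,k)$ is the pair $$\bigl(i,\{\mathit{view}(s,\omega,k-1) : s\in S_k^1\cup\dots\cup S_k^j\}\bigr).$$ **Solvability.** A protocol $\Pi$ is a partial map from the set of all views that occur in some run with some $\omega$ to the vertices of $\mathcal O$. The task $T$ is solvable in the wait-free model if there is a protocol $\Pi$ such that, for every run $r$ and every $n$-simplex $\omega$ of $\mathcal I$: 1. for every process $i$ there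 are $k_0\ge0$ and a vertex $v$ of $\mathcal O$ colored $i$ such that, for every $k$ for which $i$ has a $k$th view, $\mathit{view}(i,\omega,k)$ is not in the domain of $\Pi$ if $k<k_0$, and $\Pi(\mathit{view}(i,\omega,k))=v$ if $k\ge k_0$; 2. for every $k$, the set of all values $\Pi(\mathit{view}(i,\omega,k))$, over the processes $i$ that have a $k$th view in the domain of $\Pi$, is contained in a simplex of $\Delta(\omega\cap\chi^{-1}(\mathit{part}(r)))$. **Corollary.** A task $T=(\mathcal I,\mathcal O,\Delta)$ is solvable in the wait-free model if and only if there exist $k\ge 0$ and a chromatic map $\eta:\operatorname{Chr}^k\mathcal I\to\mathcal O$ such that $\eta(\sigma)\in\Delta(\tau)$ for every simplex $\tau$ of $\mathcal I$ and every simplex $\sigma$ of $\operatorname{Chr}^k\tau\subseteq\operatorname{Chr}^k\mathcal I$. -/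

import Mathlib

/-! ### Chromatic complexes -/

/-- A chromatic complex with colors `0, …, n`: a simplicial complex together with a coloring of
its vertices that is injective on every simplex, i.e. a noncollapsing simplicial map to the
standard `n`-simplex.  The vertices are the `v : V` with `{v}` a simplex; the values of
`color` elsewhere carry no information. -/
structure ChromaticComplex (n : ℕ) (V : Type*) extends PreAbstractSimplicialComplex V where
  color : V → Fin (n + 1)
  color_injOn : ∀ σ ∈ faces, Set.InjOn color (σ : Set V)

/-- The set of vertices of a simplicial complex. -/
def PreAbstractSimplicialComplex.vertices {V : Type*} (K : PreAbstractSimplicialComplex V) :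
    Set V :=
  {v | {v} ∈ K.faces}

/-- `K` is pure of dimension `m`: no simplex has dimension `> m` (i.e. more than `m + 1` vertices),
and each simplex is a face of an `m`-dimensional one.  The empty complex is pure. -/
def PreAbstractSimplicialComplex.IsPure {V : Type*} (K : PreAbstractSimplicialComplex V)
    (m : ℕ) : Prop :=
  (∀ σ ∈ K.faces, σ.card ≤ m + 1) ∧
    ∀ σ ∈ K.faces, ∃ τ ∈ K.faces, σ ⊆ τ ∧ τ.card = m + 1

namespace ChromaticComplex

variable {n : ℕ} {V : Type*}

/-- The subcomplex of `C` formed by the simplices all of whose vertices lie in `τ`.  When `τ` is a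
simplex of `C`, this is `τ` viewed as a complex (all the faces of `τ`). -/
def restrict (C : ChromaticComplex n V) (τ : Finset V) : ChromaticComplex n V where
  faces := {σ | σ ∈ C.faces ∧ σ ⊆ τ}
  isRelLowerSet_faces := fun _ hσ =>
    ⟨(C.isRelLowerSet_faces hσ.1).1, fun _ hρ hne =>
      ⟨(C.isRelLowerSet_faces hσ.1).2 hρ hne, subset_trans hρ hσ.2⟩⟩
  color := C.color
  color_injOn := fun σ hσ => C.color_injOn σ hσ.1

/-- The standard chromatic subdivision `Chr C`.  Its vertices are pairs `(p, t)` with `p ∈ t`, `t` a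
simplex of `C`, and `(p, t)` has the color of `p`.  For a simplex `σ` of `C`, the top simplices of
the subdivision of `σ` are the tuples `((p, t p))`, for `p ∈ σ`, where each `t p` is a face of `σ`
containing `p`, any two of the `t p` are comparable, and `q ∈ t p` implies `t q ⊆ t p`.  The
simplices of `Chr C` are the nonempty subsets of such tuples. -/
def chr (C : ChromaticComplex n V) : ChromaticComplex n (V × Finset V) where
  faces := {s | s.Nonempty ∧ ∃ σ ∈ C.faces, ∃ t : V → Finset V,
    (∀ p ∈ σ, p ∈ t p ∧ t p ⊆ σ) ∧
    (∀ p ∈ σ, ∀ q ∈ σ, t p ⊆ t q ∨ t q ⊆ t p) ∧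
    (∀ p ∈ σ, ∀ q ∈ t p, t q ⊆ t p) ∧
    ∀ x ∈ s, x.1 ∈ σ ∧ x.2 = t x.1}
  isRelLowerSet_faces := by
    rintro s ⟨hs, σ, hσ, t, h1, h2, h3, h4⟩
    exact ⟨hs, fun u hu hne => ⟨hne, σ, hσ, t, h1, h2, h3, fun x hx => h4 x (hu hx)⟩⟩
  color := fun x => C.color x.1
  color_injOn := by
    rintro s ⟨-, σ, hσ, t, -, -, -, h4⟩ x hx y hy hxy
    have h : x.1 = y.1 := C.color_injOn σ hσ (h4 x hx).1 (h4 y hy).1 hxy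
    refine Prod.ext h ?_
    rw [(h4 x hx).2, (h4 y hy).2, h]

end ChromaticComplex

/-- The ambient type for the vertices of the `k`th iterated chromatic subdivision. -/
def ChrVertex (V : Type*) : ℕ → Type _
  | 0 => V
  | k + 1 => ChrVertex V k × Finset (ChrVertex V k)

namespace ChromaticComplex

variable {n : ℕ} {V W : Type*}

/-- The `k`th chromatic subdivision `Chr^k C`. -/
def chrIter (C : ChromaticComplex n V) : (k : ℕ) → ChromaticComplex n (ChrVertex V k)
  | 0 => C
  | k + 1 => (C.chrIter k).chr

/-- The `n`-dimensional simplices of `C`. -/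
def Facet (C : ChromaticComplex n V) : Type _ :=
  {ω : Finset V // ω ∈ C.faces ∧ ω.card = n + 1}

theorem Facet.exists_vertex {C : ChromaticComplex n V} (ω : C.Facet) (i : Fin (n + 1)) :
    ∃ v ∈ ω.1, C.color v = i := by
  classical
  have h : ω.1.image C.color = Finset.univ := by
    apply Finset.eq_univ_of_card
    rw [Finset.card_image_of_injOn (C.color_injOn _ ω.2.1), ω.2.2, Fintype.card_fin]
  have hi : i ∈ ω.1.image C.color := h ▸ Finset.mem_univ i
  simpa using hi

/-- The (unique) vertex of color `i` of an `n`-dimensional simplex. -/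
noncomputable def Facet.vertex {C : ChromaticComplex n V} (ω : C.Facet) (i : Fin (n + 1)) : V :=
  (ω.exists_vertex i).choose

/-- The face `ω ∩ χ⁻¹(P)` of an `n`-dimensional simplex `ω`. -/
def Facet.colored {C : ChromaticComplex n V} (ω : C.Facet) (P : Finset (Fin (n + 1))) :
    Finset V :=
  ω.1.filter (fun v => C.color v ∈ P)

end ChromaticComplex

/-- The image of a simplex `σ` of `A` under a map `f` on the vertices of `A`. -/
noncomputable def vertexImage {n : ℕ} {V W : Type*} {A : ChromaticComplex n V}
    (f : A.vertices → W) (σ : Finset V) : Finset W :=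
  open Classical in (σ.subtype (fun v => v ∈ A.vertices)).image f

/-- A chromatic map: a simplicial map that preserves colors. -/
structure ChromaticMap {n : ℕ} {V W : Type*} (A : ChromaticComplex n V)
    (B : ChromaticComplex n W) where
  toFun : A.vertices → W
  map_faces : ∀ σ ∈ A.faces, vertexImage toFun σ ∈ B.faces
  color_eq : ∀ v : A.vertices, B.color (toFun v) = A.color v

/-- The image `f(σ)` of a simplex under a chromatic map. -/
noncomputable def ChromaticMap.image {n : ℕ} {V W : Type*} {A : ChromaticComplex n V}
    {B : ChromaticComplex n W} (f : ChromaticMap A B) (σ : Finset V) : Finset W :=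
  vertexImage f.toFun σ

open Classical in
/-- A chromatic multi-map `Δ : A → 2^B`: it sends every `m`-simplex `σ` of `A` to a pure
`m`-dimensional, possibly empty, subcomplex `Δ(σ)` of `B`, such that the colors of `Δ(σ)`, if it is
not empty, are those of `σ`, and `Δ(σ ∩ τ) ⊆ Δ(σ) ∩ Δ(τ)`. -/
structure ChromaticMultiMap {n : ℕ} {V W : Type*} (A : ChromaticComplex n V)
    (B : ChromaticComplex n W) where
  toFun : Finset V → PreAbstractSimplicialComplex W
  faces_subset : ∀ σ ∈ A.faces, (toFun σ).faces ⊆ B.faces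
  pure : ∀ σ ∈ A.faces, ∀ m : ℕ, σ.card = m + 1 → (toFun σ).IsPure m
  colors : ∀ σ ∈ A.faces, (toFun σ).faces.Nonempty →
    B.color '' (toFun σ).vertices = A.color '' (σ : Set V)
  inter : ∀ σ ∈ A.faces, ∀ τ ∈ A.faces, (σ ∩ τ).Nonempty →
    (toFun (σ ∩ τ)).faces ⊆ (toFun σ).faces ∩ (toFun τ).faces

/-- A task on the processes `0, …, n`. -/
structure DistTask (n : ℕ) (V W : Type*) where
  input : ChromaticComplex n V
  output : ChromaticComplex n W
  input_finite : input.faces.Finite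
  output_finite : output.faces.Finite
  input_pure : input.IsPure n
  output_pure : output.IsPure n
  Δ : ChromaticMultiMap input output

/-! ### The iterated immediate snapshot model -/

/-- One immediate snapshot: a nonempty set of processes with an ordered partition into nonempty
blocks. -/
structure ISRound (n : ℕ) where
  blocks : List (Finset (Fin (n + 1)))
  blocks_ne_nil : blocks ≠ []
  block_nonempty : ∀ B ∈ blocks, B.Nonempty
  blocks_disjoint : blocks.Pairwise Disjoint

namespace ISRound

variable {n : ℕ}

/-- The processes taking part in the immediate snapshot. -/
def participants (S : ISRound n) : Finset (Fin (n + 1)) :=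
  Finset.univ.filter (fun i => ∃ B ∈ S.blocks, i ∈ B)

/-- The processes seen by `i`: if `i` is in the `b`th block, the union of the blocks up to the
`b`th, itself included. -/
def seen (S : ISRound n) (i : Fin (n + 1)) : Set (Fin (n + 1)) :=
  {s | ∃ a b : Fin S.blocks.length, a ≤ b ∧ s ∈ S.blocks.get a ∧ i ∈ S.blocks.get b}

end ISRound

/-- A run `S₁ ⊇ S₂ ⊇ ⋯` of the IIS model; `round k` is `S_{k+1}` with its ordered partition. -/
structure IISRun (n : ℕ) where
  round : ℕ → ISRound n
  decreasing : ∀ k, (round (k + 1)).participants ⊆ (round k).participants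

/-- The set `part(r)` of participating processes. -/
def IISRun.part {n : ℕ} (r : IISRun n) : Finset (Fin (n + 1)) :=
  (r.round 0).participants

/-- Process `i` has a `k`th view in the run: `k = 0`, or `i` is in `S_k`. -/
def IISRun.HasView {n : ℕ} (r : IISRun n) (i : Fin (n + 1)) : ℕ → Prop
  | 0 => True
  | k + 1 => i ∈ (r.round k).participants

/-- The type of `k`th views: a process identity with an input vertex for `k = 0`, and a process
identity with a set of `k`th views for `k + 1`. The first component is the process
that holds the view. -/
def IISView (n : ℕ) (V : Type*) : ℕ → Type _
  | 0 => Fin (n + 1) × V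
  | k + 1 => Fin (n + 1) × Set (IISView n V k)

/-- The `k`th view of process `i` in the run `r` with input `ω` (meaningful if `r.HasView i k`). -/
noncomputable def IISRun.view {n : ℕ} {V : Type*} {I : ChromaticComplex n V} (r : IISRun n)
    (ω : I.Facet) : (k : ℕ) → Fin (n + 1) → IISView n V k
  | 0, i => (i, ω.vertex i)
  | k + 1, i => (i, r.view ω k '' (r.round k).seen i)

/-- The set of `k`th views that occur in some run of the IIS model with inputs from `I`. -/
def occurringViews {n : ℕ} {V : Type*} (I : ChromaticComplex n V) (k : ℕ) :
    Set (IISView n V k) :=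
  {w | ∃ (r : IISRun n) (ω : I.Facet) (i : Fin (n + 1)), r.HasView i k ∧ w = r.view ω k i}

namespace DistTask

variable {n : ℕ} {V W : Type*}

/-- A protocol: a partial map from the occurring views to the vertices of the output complex
(`none` outside the domain). -/
structure Protocol (T : DistTask n V W) where
  out : (k : ℕ) → IISView n V k → Option W
  dom_subset : ∀ k w, out k w ≠ none → w ∈ occurringViews T.input k
  out_vertex : ∀ k w v, out k w = some v → v ∈ T.output.vertices

/-- The protocol `P` solves the task `T` in the model `M`, a set of runs of the IIS model. -/
def Protocol.Solves {T : DistTask n V W} (P : T.Protocol) (M : Set (IISRun n)) : Prop :=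
  ∀ r ∈ M, ∀ ω : T.input.Facet,
    (∀ i : Fin (n + 1), ∃ k₀ : ℕ, ∃ v ∈ T.output.vertices, T.output.color v = i ∧
      (∀ k < k₀, r.HasView i k → P.out k (r.view ω k i) = none) ∧
      (∀ k ≥ k₀, r.HasView i k → P.out k (r.view ω k i) = some v)) ∧
    (∀ k : ℕ, ∃ ρ ∈ (T.Δ.toFun (ω.colored r.part)).faces,
      {v | ∃ i, r.HasView i k ∧ P.out k (r.view ω k i) = some v} ⊆ (ρ : Set W))

/-- The task is solvable in the model `M`. -/
def SolvableIn (T : DistTask n V W) (M : Set (IISRun n)) : Prop :=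
  ∃ P : T.Protocol, P.Solves M

end DistTask

/-- The wait-free model: all the runs of the IIS model. -/
def waitFree (n : ℕ) : Set (IISRun n) := Set.univ

/-! Views and vertices of the subdivisions are the same data. One round of immediate snapshots
assigns to each participant the set it sees; such families are exactly the self-containing,
comparable, transitive ones (`ISRound.exists_seen_eq`), which are the conditions defining a simplex
of `Chr`. Iterating, the active processes of a run span a simplex of `Chr^k` of the participating
face (`image_chrVertex_mem_faces`), every simplex of `Chr^k τ` lies in one of this form
(`exists_subset_image_chrVertex`), and equality of `k`th views of active processes amounts to
equality of vertices (`chrVertex_eq_of_view_eq`, `view_eq_of_chrVertex_eq`).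

Given a map `η` on `Chr^k`, a process decides by applying `η` to the vertex of its `k`th view.
Conversely, a protocol yields a map on `Chr^k` once all active processes have decided by one common
time `k`. Such a time exists by compactness: there are finitely many possible rounds and finitely
many input facets, so runs form a compact space on which having decided by time `k` is an increasing
open cover (`IISRun.exists_uniform`). -/

/-! ### Immediate snapshots -/

namespace ISRound

variable {n : ℕ} (S : ISRound n)

theorem mem_participants {i : Fin (n + 1)} : i ∈ S.participants ↔ ∃ B ∈ S.blocks, i ∈ B := by
  simp [participants]

theorem participants_nonempty : S.participants.Nonempty := by
  obtain ⟨B, hB⟩ := List.exists_mem_of_ne_nil _ S.blocks_ne_nil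
  obtain ⟨i, hi⟩ := S.block_nonempty B hB
  exact ⟨i, S.mem_participants.2 ⟨B, hB, hi⟩⟩

theorem block_index_unique {i : Fin (n + 1)} {a b : Fin S.blocks.length}
    (ha : i ∈ S.blocks.get a) (hb : i ∈ S.blocks.get b) : a = b := by
  by_contra h
  have key := List.pairwise_iff_get.1 S.blocks_disjoint
  rcases lt_or_gt_of_ne h with h | h
  · exact Finset.disjoint_left.1 (key _ _ h) ha hb
  · exact Finset.disjoint_left.1 (key _ _ h) hb ha

theorem exists_block_index {i : Fin (n + 1)} (hi : i ∈ S.participants) :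
    ∃ a : Fin S.blocks.length, i ∈ S.blocks.get a := by
  obtain ⟨B, hB, hiB⟩ := S.mem_participants.1 hi
  obtain ⟨a, rfl⟩ := List.get_of_mem hB
  exact ⟨a, hiB⟩

theorem mem_seen_self {i : Fin (n + 1)} (hi : i ∈ S.participants) : i ∈ S.seen i := by
  obtain ⟨a, ha⟩ := S.exists_block_index hi
  exact ⟨a, a, le_rfl, ha, ha⟩

theorem mem_participants_of_mem_seen {i s : Fin (n + 1)} (h : s ∈ S.seen i) :
    s ∈ S.participants := by
  obtain ⟨a, b, -, hs, -⟩ := h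
  exact S.mem_participants.2 ⟨_, List.get_mem _ _, hs⟩

theorem seen_subset_of_mem_seen {i s : Fin (n + 1)} (h : s ∈ S.seen i) :
    S.seen s ⊆ S.seen i := by
  obtain ⟨a, b, hab, hs, hi⟩ := h
  rintro u ⟨c, d, hcd, hu, hs'⟩
  obtain rfl := S.block_index_unique hs hs'
  exact ⟨c, b, hcd.trans hab, hu, hi⟩

theorem seen_total {i j : Fin (n + 1)} (hi : i ∈ S.participants) (hj : j ∈ S.participants) :
    S.seen i ⊆ S.seen j ∨ S.seen j ⊆ S.seen i := by
  obtain ⟨a, ha⟩ := S.exists_block_index hi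
  obtain ⟨b, hb⟩ := S.exists_block_index hj
  rcases le_total a b with h | h
  · exact .inl (S.seen_subset_of_mem_seen ⟨a, b, h, ha, hb⟩)
  · exact .inr (S.seen_subset_of_mem_seen ⟨b, a, h, hb, ha⟩)

/-- Any family of sets with the containment properties of immediate snapshots comes from an ordered
partition. -/
theorem exists_seen_eq {P : Finset (Fin (n + 1))} (hP : P.Nonempty)
    (f : Fin (n + 1) → Finset (Fin (n + 1))) (hself : ∀ i ∈ P, i ∈ f i) (hsub : ∀ i ∈ P, f i ⊆ P)
    (htotal : ∀ i ∈ P, ∀ j ∈ P, f i ⊆ f j ∨ f j ⊆ f i)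
    (hmono : ∀ i ∈ P, ∀ j ∈ f i, f j ⊆ f i) :
    ∃ S : ISRound n, S.participants = P ∧ ∀ i ∈ P, S.seen i = f i := by
  -- In a chain of finite sets the cardinality determines the set, so the level sets of `c` on `P`,
  -- in increasing order, are the blocks.
  let c : Fin (n + 1) → ℕ := fun i => (f i).card
  let block : ℕ → Finset (Fin (n + 1)) := fun m => P.filter (fun i => c i = m)
  let L : List ℕ := (P.image c).sort (· ≤ ·)
  have hL : ∀ m, m ∈ L ↔ ∃ i ∈ P, c i = m := fun m => by simp [L]
  have hLs : L.Pairwise (· < ·) := (Finset.sortedLT_sort (P.image c)).pairwise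
  let S : ISRound n :=
    { blocks := L.map block
      blocks_ne_nil := by
        obtain ⟨i, hi⟩ := hP
        have : c i ∈ L := (hL _).2 ⟨i, hi, rfl⟩
        intro h
        rw [List.map_eq_nil_iff] at h
        simp [h] at this
      block_nonempty := by
        intro B hB
        obtain ⟨m, hm, rfl⟩ := List.mem_map.1 hB
        obtain ⟨i, hi, him⟩ := (hL m).1 hm
        exact ⟨i, Finset.mem_filter.2 ⟨hi, him⟩⟩
      blocks_disjoint := by
        refine hLs.map _ fun a b hab => Finset.disjoint_left.2 fun i hia hib => hab.ne ?_
        exact (Finset.mem_filter.1 hia).2.symm.trans (Finset.mem_filter.1 hib).2 }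
  have hpart : S.participants = P := by
    ext i
    rw [mem_participants]
    constructor
    · rintro ⟨B, hB, hi⟩
      obtain ⟨m, -, rfl⟩ := List.mem_map.1 hB
      exact (Finset.mem_filter.1 hi).1
    · exact fun hi => ⟨block (c i), List.mem_map.2 ⟨_, (hL _).2 ⟨i, hi, rfl⟩, rfl⟩,
        Finset.mem_filter.2 ⟨hi, rfl⟩⟩
  have hlen : S.blocks.length = L.length := List.length_map _
  have hget : ∀ (a : Fin S.blocks.length) (i : Fin (n + 1)),
      i ∈ S.blocks.get a ↔ i ∈ P ∧ c i = L.get (a.cast hlen) := by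
    intro a i
    simp [S, block]
  have hle : ∀ a b : Fin S.blocks.length,
      a ≤ b ↔ L.get (a.cast hlen) ≤ L.get (b.cast hlen) := by
    intro a b
    have hlt : ∀ a b : Fin S.blocks.length, a < b →
        L.get (a.cast hlen) < L.get (b.cast hlen) := fun a b h =>
      List.pairwise_iff_get.1 hLs _ _ h
    constructor
    · intro h
      rcases h.lt_or_eq with h | rfl
      · exact (hlt _ _ h).le
      · exact le_rfl
    · intro h
      by_contra hba
      exact absurd (hlt _ _ (not_le.1 hba)) (not_lt.2 h)
  have hseen : ∀ i ∈ P, ∀ s, s ∈ S.seen i ↔ s ∈ P ∧ c s ≤ c i := by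
    intro i hi s
    constructor
    · rintro ⟨a, b, hab, hs, hi⟩
      rw [hget] at hs hi
      rw [hle, ← hs.2, ← hi.2] at hab
      exact ⟨hs.1, hab⟩
    · rintro ⟨hs, hc⟩
      obtain ⟨a, ha⟩ := S.exists_block_index (hpart ▸ hs)
      obtain ⟨b, hb⟩ := S.exists_block_index (hpart ▸ hi)
      refine ⟨a, b, ?_, ha, hb⟩
      rw [hle, ← ((hget _ _).1 ha).2, ← ((hget _ _).1 hb).2]
      exact hc
  refine ⟨S, hpart, fun i hi => Set.ext fun s => (hseen i hi s).trans ?_⟩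
  constructor
  · rintro ⟨hs, hc⟩
    rcases htotal s hs i hi with h | h
    · exact h (hself s hs)
    · have := Finset.eq_of_subset_of_card_le h hc
      exact Finset.mem_coe.2 (this ▸ hself s hs)
  · intro hs
    exact ⟨hsub i hi hs, Finset.card_le_card (hmono i hi s hs)⟩

theorem blocks_nodup : S.blocks.Nodup :=
  S.blocks_disjoint.imp_of_mem fun {A B} hA _ h hAB => by
    subst hAB
    exact (S.block_nonempty A hA).ne_empty (disjoint_self.1 h)

/-- Disjoint nonempty blocks cannot repeat, and a finite type has finitely many duplicate-free
lists. This finiteness makes the space of runs compact. -/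
instance : Finite (ISRound n) :=
  Finite.of_injective (β := {l : List (Finset (Fin (n + 1))) // l.Nodup})
    (fun S => ⟨S.blocks, S.blocks_nodup⟩) fun S S' h => by
      cases S
      cases S'
      simpa using h

end ISRound

/-! ### Subdivisions of restrictions -/

namespace ChromaticComplex

variable {n : ℕ} {V : Type*}

theorem vertex_mem {C : ChromaticComplex n V} (ω : C.Facet) (i : Fin (n + 1)) :
    ω.vertex i ∈ ω.1 :=
  (ω.exists_vertex i).choose_spec.1

theorem color_vertex {C : ChromaticComplex n V} (ω : C.Facet) (i : Fin (n + 1)) :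
    C.color (ω.vertex i) = i :=
  (ω.exists_vertex i).choose_spec.2

theorem vertex_color {C : ChromaticComplex n V} (ω : C.Facet) {v : V} (hv : v ∈ ω.1) :
    ω.vertex (C.color v) = v :=
  C.color_injOn _ ω.2.1 (vertex_mem ω _) hv (color_vertex ω _)

theorem mem_colored {C : ChromaticComplex n V} (ω : C.Facet) {P : Finset (Fin (n + 1))} {v : V} :
    v ∈ ω.colored P ↔ v ∈ ω.1 ∧ C.color v ∈ P :=
  Finset.mem_filter

theorem colored_mem_faces {C : ChromaticComplex n V} (ω : C.Facet) {P : Finset (Fin (n + 1))}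
    (hP : P.Nonempty) : ω.colored P ∈ C.faces := by
  obtain ⟨i, hi⟩ := hP
  refine (C.isRelLowerSet_faces ω.2.1).2 (Finset.filter_subset _ _)
    ⟨ω.vertex i, (mem_colored ω).2 ⟨vertex_mem ω i, ?_⟩⟩
  rwa [color_vertex]

theorem chr_faces_mono {C D : ChromaticComplex n V} (h : C.faces ⊆ D.faces) :
    C.chr.faces ⊆ D.chr.faces := fun _ ⟨hs, σ, hσ, t⟩ => ⟨hs, σ, h hσ, t⟩

theorem restrict_chrIter_faces_subset (C : ChromaticComplex n V) (τ : Finset V) (k : ℕ) :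
    ((C.restrict τ).chrIter k).faces ⊆ (C.chrIter k).faces := by
  induction k with
  | zero => exact fun σ hσ => hσ.1
  | succ k ih => exact chr_faces_mono ih

theorem exists_carrier (C : ChromaticComplex n V) (k : ℕ) {σ : Finset (ChrVertex V k)}
    (hσ : σ ∈ (C.chrIter k).faces) :
    ∃ τ ∈ C.faces, σ ∈ ((C.restrict τ).chrIter k).faces := by
  induction k with
  | zero => exact ⟨σ, hσ, hσ, subset_rfl⟩
  | succ k ih =>
    obtain ⟨hs, σ', hσ', t⟩ := hσ
    obtain ⟨τ, hτ, h⟩ := ih hσ'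
    exact ⟨τ, hτ, hs, σ', h, t⟩

theorem singleton_mem_faces (C : ChromaticComplex n V) {σ : Finset V} (hσ : σ ∈ C.faces) {v : V}
    (hv : v ∈ σ) : v ∈ C.vertices :=
  (C.isRelLowerSet_faces hσ).2 (Finset.singleton_subset_iff.2 hv) ⟨v, Finset.mem_singleton_self v⟩

end ChromaticComplex

theorem mem_vertexImage {n : ℕ} {V W : Type*} {A : ChromaticComplex n V} {f : A.vertices → W}
    {σ : Finset V} {w : W} :
    w ∈ vertexImage f σ ↔ ∃ v : A.vertices, v.1 ∈ σ ∧ f v = w := by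
  simp [vertexImage]

/-! ### Views and vertices of the subdivisions -/

namespace IISRun

open Classical in
/-- The vertex of the `k`th chromatic subdivision that corresponds to the `k`th view of `i`. -/
noncomputable def chrVertex {n : ℕ} {V : Type*} {I : ChromaticComplex n V} (r : IISRun n)
    (ω : I.Facet) : (k : ℕ) → Fin (n + 1) → ChrVertex V k
  | 0, i => ω.vertex i
  | k + 1, i => (r.chrVertex ω k i,
      (Finset.univ.filter (fun s => s ∈ (r.round k).seen i)).image (r.chrVertex ω k))

/-- The participating processes that have a `k`th view. -/
def active {n : ℕ} (r : IISRun n) : ℕ → Finset (Fin (n + 1))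
  -- Every process has a `0`th view, even one that never participates; only participants may
  -- contribute vertices to the simplex.
  | 0 => r.part
  | k + 1 => (r.round k).participants

variable {n : ℕ} {V : Type*} {I : ChromaticComplex n V} (r r' : IISRun n) (ω ω' : I.Facet)

theorem active_succ_subset (k : ℕ) : r.active (k + 1) ⊆ r.active k := by
  cases k with
  | zero => exact subset_rfl
  | succ k => exact r.decreasing k

theorem active_antitone : Antitone r.active :=
  antitone_nat_of_succ_le r.active_succ_subset

theorem active_nonempty (k : ℕ) : (r.active k).Nonempty := by
  cases k <;> exact ISRound.participants_nonempty _

theorem hasView_of_mem_active {k : ℕ} {i : Fin (n + 1)} (h : i ∈ r.active k) : r.HasView i k := by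
  cases k with
  | zero => trivial
  | succ k => exact h

theorem view_congr {k : ℕ} (h : ∀ m < k, r.round m = r'.round m) (i : Fin (n + 1)) :
    r.view ω k i = r'.view ω k i := by
  induction k generalizing i with
  | zero => rfl
  | succ k ih =>
    have ih' : r.view ω k = r'.view ω k := funext fun i => ih (fun m hm => h m (by omega)) i
    simp only [view, ih', h k k.lt_succ_self]
    rfl

theorem chrVertex_congr {k : ℕ} (h : ∀ m < k, r.round m = r'.round m) :
    r.chrVertex ω k = r'.chrVertex ω k := by
  induction k with
  | zero => rfl
  | succ k ih =>
    funext i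
    rw [chrVertex, chrVertex, ih (fun m hm => h m (by omega)), h k k.lt_succ_self]

theorem view_fst_injective {k : ℕ} {i i' : Fin (n + 1)}
    (h : r.view ω k i = r'.view ω' k i') : i = i' := by
  cases k <;> exact congrArg Prod.fst h

/-- A process in the round sees itself, so its previous view is an element of its snapshot,
identified there by its first component. -/
theorem view_of_view_succ {k : ℕ} {i i' : Fin (n + 1)} (hi : r.HasView i (k + 1))
    (h : r.view ω (k + 1) i = r'.view ω' (k + 1) i') :
    r.view ω k i = r'.view ω' k i' := by
  obtain rfl := view_fst_injective _ _ _ _ h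
  have hs : r.view ω k '' (r.round k).seen i = r'.view ω' k '' (r'.round k).seen i :=
    congrArg Prod.snd h
  have hmem : r.view ω k i ∈ r'.view ω' k '' (r'.round k).seen i :=
    hs ▸ ⟨i, (r.round k).mem_seen_self hi, rfl⟩
  obtain ⟨s, -, hs⟩ := hmem
  obtain rfl := view_fst_injective _ _ _ _ hs
  exact hs.symm

theorem view_of_view_le {k m : ℕ} (hkm : k ≤ m) {i i' : Fin (n + 1)} (hi : i ∈ r.active m)
    (h : r.view ω m i = r'.view ω' m i') : r.view ω k i = r'.view ω' k i' := by
  induction m, hkm using Nat.le_induction with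
  | base => exact h
  | succ m _ ih =>
    exact ih (r.active_succ_subset m hi) (view_of_view_succ _ _ _ _ hi h)

/-- A vertex of `Chr` records its underlying vertex as well as a set, whereas a view keeps only the
process name and the set. Activity allows the missing component to be recovered from the set by
`view_of_view_succ`. -/
theorem chrVertex_eq_of_view_eq {k : ℕ} {i i' : Fin (n + 1)} (hi : i ∈ r.active k)
    (hi' : i' ∈ r'.active k) (h : r.view ω k i = r'.view ω' k i') :
    r.chrVertex ω k i = r'.chrVertex ω' k i' := by
  induction k generalizing i i' with
  | zero => exact congrArg Prod.snd h
  | succ k ih =>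
    have hs : r.view ω k '' (r.round k).seen i = r'.view ω' k '' (r'.round k).seen i' :=
      congrArg Prod.snd h
    refine Prod.ext ?_ (Finset.ext fun x => ?_)
    · exact ih (r.active_succ_subset k hi) (r'.active_succ_subset k hi')
        (view_of_view_succ _ _ _ _ hi h)
    · have hact : ∀ {s}, s ∈ (r.round k).seen i → s ∈ r.active k := fun hs =>
        r.active_succ_subset k ((r.round k).mem_participants_of_mem_seen hs)
      have hact' : ∀ {s}, s ∈ (r'.round k).seen i' → s ∈ r'.active k := fun hs =>
        r'.active_succ_subset k ((r'.round k).mem_participants_of_mem_seen hs)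
      simp only [chrVertex, Finset.mem_image, Finset.mem_filter, Finset.mem_univ, true_and]
      constructor
      · rintro ⟨s, hsi, rfl⟩
        obtain ⟨s', hsi', he⟩ := hs ▸ Set.mem_image_of_mem (r.view ω k) hsi
        exact ⟨s', hsi', (ih (hact hsi) (hact' hsi') he.symm).symm⟩
      · rintro ⟨s', hsi', rfl⟩
        obtain ⟨s, hsi, he⟩ := hs.symm ▸ Set.mem_image_of_mem (r'.view ω' k) hsi'
        exact ⟨s, hsi, ih (hact hsi) (hact' hsi') he⟩

theorem color_chrVertex (k : ℕ) (i : Fin (n + 1)) :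
    (I.chrIter k).color (r.chrVertex ω k i) = i := by
  induction k with
  | zero => exact ChromaticComplex.color_vertex ω i
  | succ k ih => exact ih

/-- The color of the vertex gives back the process, so activity plays no role in this direction. -/
theorem view_eq_of_chrVertex_eq {k : ℕ} {i i' : Fin (n + 1)}
    (h : r.chrVertex ω k i = r'.chrVertex ω' k i') : r.view ω k i = r'.view ω' k i' := by
  have hi : ∀ {k i i'}, r.chrVertex ω k i = r'.chrVertex ω' k i' → i = i' := fun {k i i'} h => by
    rw [← r.color_chrVertex ω k i, h, color_chrVertex]
  induction k generalizing i i' with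
  | zero => exact Prod.ext (hi h) h
  | succ k ih =>
    have hs := congrArg Prod.snd h
    refine Prod.ext (hi h) (Set.ext fun w => ?_)
    simp only [chrVertex, Finset.ext_iff, Finset.mem_image, Finset.mem_filter, Finset.mem_univ,
      true_and] at hs
    constructor
    · rintro ⟨s, hsi, rfl⟩
      obtain ⟨s', hsi', he⟩ := (hs _).1 ⟨s, hsi, rfl⟩
      exact ⟨s', hsi', (ih he.symm).symm⟩
    · rintro ⟨s', hsi', rfl⟩
      obtain ⟨s, hsi, he⟩ := (hs _).2 ⟨s', hsi', rfl⟩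
      exact ⟨s, hsi, ih he⟩

open Classical in
theorem image_chrVertex_mem_faces (k : ℕ) :
    (r.active k).image (r.chrVertex ω k) ∈ ((I.restrict (ω.colored r.part)).chrIter k).faces := by
  induction k with
  | zero =>
    have h : (r.active 0).image (r.chrVertex ω 0) = ω.colored r.part := by
      ext v
      refine Finset.mem_image.trans (Iff.trans ?_ (ChromaticComplex.mem_colored ω).symm)
      constructor
      · rintro ⟨i, hi, rfl⟩
        refine ⟨ChromaticComplex.vertex_mem ω i, ?_⟩
        have := ChromaticComplex.color_vertex ω i
        exact this.symm ▸ hi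
      · rintro ⟨hv, hc⟩
        exact ⟨_, hc, ChromaticComplex.vertex_color ω hv⟩
    rw [h]
    exact ⟨ChromaticComplex.colored_mem_faces ω (r.active_nonempty 0), subset_rfl⟩
  | succ k ih =>
    set x := r.chrVertex ω k
    set S := r.round k
    have hne : ((r.active (k + 1)).image (r.chrVertex ω (k + 1))).Nonempty :=
      (r.active_nonempty (k + 1)).image _
    have hmem : ∀ y ∈ (r.active (k + 1)).image (r.chrVertex ω (k + 1)),
        ∃ i ∈ r.active (k + 1), r.chrVertex ω (k + 1) i = y := fun y hy => Finset.mem_image.1 hy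
    refine ⟨hne, (r.active (k + 1)).image x, ?_,
      -- The witness must be a function of vertices; the color of `p` recovers the process that
      -- holds it.
      fun p => (Finset.univ.filter (fun s => s ∈ S.seen ((I.chrIter k).color p))).image x,
      ?_, ?_, ?_, ?_⟩
    · exact (((I.restrict _).chrIter k).isRelLowerSet_faces ih).2
        (Finset.image_subset_image (r.active_succ_subset k)) ((r.active_nonempty (k + 1)).image _)
    · intro p hp
      obtain ⟨i, hi, rfl⟩ := Finset.mem_image.1 hp
      simp only [x, color_chrVertex]
      refine ⟨Finset.mem_image_of_mem _ (Finset.mem_filter.2 ⟨Finset.mem_univ _,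
        S.mem_seen_self hi⟩), Finset.image_subset_image fun s hs => ?_⟩
      exact S.mem_participants_of_mem_seen (Finset.mem_filter.1 hs).2
    · intro p hp q hq
      obtain ⟨i, hi, rfl⟩ := Finset.mem_image.1 hp
      obtain ⟨j, hj, rfl⟩ := Finset.mem_image.1 hq
      simp only [x, color_chrVertex]
      refine (S.seen_total hi hj).imp (fun h => ?_) (fun h => ?_) <;>
      exact Finset.image_subset_image (Finset.monotone_filter_right _ fun s _ hs => h hs)
    · intro p hp q hq
      obtain ⟨i, hi, rfl⟩ := Finset.mem_image.1 hp
      obtain ⟨j, hj, rfl⟩ := Finset.mem_image.1 hq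
      simp only [x, color_chrVertex, Finset.mem_filter, Finset.mem_univ, true_and] at hj ⊢
      exact Finset.image_subset_image (Finset.monotone_filter_right _ fun s _ hs =>
        S.seen_subset_of_mem_seen hj hs)
    · intro y hy
      obtain ⟨i, hi, rfl⟩ := hmem y hy
      refine ⟨Finset.mem_image_of_mem x hi, ?_⟩
      change _ = (Finset.univ.filter (fun s => s ∈ S.seen ((I.chrIter k).color (x i)))).image x
      rw [show (I.chrIter k).color (x i) = i from r.color_chrVertex ω k i]
      rfl

/-- The run that follows `r` for `k` rounds and repeats the round `S` afterwards. -/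
def splice (k : ℕ) (S : ISRound n) (hS : S.participants ⊆ r.active k) : IISRun n where
  round m := if m < k then r.round m else S
  decreasing m := by
    rcases lt_trichotomy (m + 1) k with h | h | h
    · simpa [h, show m < k by omega] using r.decreasing m
    · subst h
      simpa [active] using hS
    · simp [show ¬ m + 1 < k by omega, show ¬ m < k by omega]

theorem splice_part_subset (k : ℕ) (S : ISRound n) (hS : S.participants ⊆ r.active k) :
    (r.splice k S hS).part ⊆ r.part := by
  cases k with
  | zero => exact hS
  | succ k => simp [part, splice]

open Classical in
-- By induction: realize the simplex `σ₀` of the previous subdivision by `k` rounds, then append a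
-- round whose snapshots are the color sets of the faces `t p`. If `σ₀` is a proper face of the
-- active simplex, the remaining processes drop out, which runs permit.
theorem exists_subset_image_chrVertex {τ : Finset V} (hτ : τ ⊆ ω.1) (k : ℕ)
    {σ : Finset (ChrVertex V k)} (hσ : σ ∈ ((I.restrict τ).chrIter k).faces) :
    ∃ r : IISRun n, r.part ⊆ τ.image I.color ∧ σ ⊆ (r.active k).image (r.chrVertex ω k) := by
  induction k with
  | zero =>
    obtain ⟨hσI, hστ⟩ : σ ∈ I.faces ∧ σ ⊆ τ := hσ
    have hne : (τ.image I.color).Nonempty := ((I.isRelLowerSet_faces hσI).1.mono hστ).image _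
    obtain ⟨S, hS, -⟩ := ISRound.exists_seen_eq hne (fun _ => τ.image I.color) (fun _ h => h)
      (fun _ _ => subset_rfl) (fun _ _ _ _ => .inl subset_rfl) (fun _ _ _ _ => subset_rfl)
    refine ⟨⟨fun _ => S, fun _ => subset_rfl⟩, hS.subset, fun v hv => ?_⟩
    refine Finset.mem_image.2 ⟨I.color v, ?_, ChromaticComplex.vertex_color ω (hτ (hστ hv))⟩
    have hv' := Finset.mem_image_of_mem I.color (hστ hv)
    rwa [← hS] at hv'
  | succ k ih =>
    obtain ⟨-, σ₀, hσ₀, t, h1, h2, h3, h4⟩ := hσ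
    obtain ⟨r, hr, hsub⟩ := ih hσ₀
    set x := r.chrVertex ω k
    have hx : ∀ p ∈ σ₀, x ((I.chrIter k).color p) = p := by
      intro p hp
      obtain ⟨i, -, rfl⟩ := Finset.mem_image.1 (hsub hp)
      simp only [x, color_chrVertex]
    set c := (I.chrIter k).color
    have hcx : ∀ i, c (x i) = i := r.color_chrVertex ω k
    have hP : ∀ i ∈ σ₀.image c, x i ∈ σ₀ := by
      intro i hi
      obtain ⟨p, hp, rfl⟩ := Finset.mem_image.1 hi
      rwa [hx p hp]
    obtain ⟨S, hSP, hS⟩ := ISRound.exists_seen_eq (P := σ₀.image c)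
      ((((I.restrict τ).chrIter k).isRelLowerSet_faces hσ₀).1.image c) (fun i => (t (x i)).image c)
      (fun i hi => Finset.mem_image.2 ⟨x i, (h1 _ (hP i hi)).1, hcx i⟩)
      (fun i hi => Finset.image_subset_image (h1 _ (hP i hi)).2)
      (fun i hi j hj => (h2 _ (hP i hi) _ (hP j hj)).imp
        Finset.image_subset_image Finset.image_subset_image)
      (by
        intro i hi j hj
        obtain ⟨q, hq, rfl⟩ := Finset.mem_image.1 hj
        rw [hx q ((h1 _ (hP i hi)).2 hq)]
        exact Finset.image_subset_image (h3 _ (hP i hi) q hq))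
    have hSr : S.participants ⊆ r.active k := by
      rw [hSP]
      intro i hi
      obtain ⟨p, hp, rfl⟩ := Finset.mem_image.1 hi
      obtain ⟨j, hj, rfl⟩ := Finset.mem_image.1 (hsub hp)
      rwa [hcx]
    refine ⟨r.splice k S hSr, (r.splice_part_subset k S hSr).trans hr, fun y hy => ?_⟩
    obtain ⟨hy1, hy2⟩ := h4 y hy
    have hround : (r.splice k S hSr).round k = S := by simp [splice]
    have hxr : (r.splice k S hSr).chrVertex ω k = x :=
      chrVertex_congr _ _ _ fun m hm => by simp [splice, hm]
    have hc : c y.1 ∈ σ₀.image c := Finset.mem_image_of_mem c hy1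
    refine Finset.mem_image.2 ⟨c y.1, ?_, Prod.ext ?_ ?_⟩
    · simpa only [active, hround, hSP] using hc
    · simpa only [chrVertex, hxr] using hx _ hy1
    · simp only [chrVertex, hxr, hround]
      rw [hy2]
      have ht := (h1 _ hy1).2
      ext q
      simp only [Finset.mem_image, Finset.mem_filter, Finset.mem_univ, true_and, hS _ hc,
        Finset.mem_coe, hx _ hy1]
      constructor
      · rintro ⟨_, ⟨q', hq', rfl⟩, rfl⟩
        rwa [hx _ (ht hq')]
      · exact fun hq => ⟨c q, ⟨q, hq, rfl⟩, hx _ (ht hq)⟩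

end IISRun

/-! ### Compactness of the wait-free model -/

/-- König's lemma for runs: a property of runs that is inherited by later times, depends at each
time on finitely many rounds, and holds eventually in every run, holds in all runs at some time. -/
theorem IISRun.exists_uniform {n : ℕ} (D : ℕ → IISRun n → Prop)
    (hsucc : ∀ k r, D k r → D (k + 1) r)
    (hcongr : ∀ k r r', (∀ m ≤ k, r.round m = r'.round m) → D k r → D k r')
    (hex : ∀ r, ∃ k, D k r) : ∃ k, ∀ r, D k r := by
  let _ : TopologicalSpace (ISRound n) := ⊥
  have : DiscreteTopology (ISRound n) := ⟨rfl⟩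
  let X : Set (ℕ → ISRound n) := {f | ∀ k, (f (k + 1)).participants ⊆ (f k).participants}
  have hX : IsClosed X := by
    have : X = ⋂ k, (fun f : ℕ → ISRound n => (f (k + 1), f k)) ⁻¹'
        {p | p.1.participants ⊆ p.2.participants} := by
      ext f
      simp [X]
    rw [this]
    -- Monotonicity of participation constrains two consecutive coordinates at a time, so it is a
    -- closed condition in the compact product.
    exact isClosed_iInter fun k => (isClosed_discrete _).preimage (by fun_prop)
  have : CompactSpace X := isCompact_iff_compactSpace.1 hX.isCompact
  let run : X → IISRun n := fun f => ⟨f.1, f.2⟩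
  let U : ℕ → Set X := fun k => {f | D k (run f)}
  have hU : ∀ k, IsOpen (U k) := by
    intro k
    let ρ : X → (Fin (k + 1) → ISRound n) := fun f m => f.1 m
    have hρ : Continuous ρ :=
      continuous_pi fun m => (continuous_apply m.1).comp continuous_subtype_val
    have : U k = ρ ⁻¹' (ρ '' U k) := by
      refine (Set.subset_preimage_image _ _).antisymm ?_
      rintro f ⟨g, hg, hgf⟩
      exact hcongr k _ _ (fun m hm => congrFun hgf ⟨m, by omega⟩) hg
    rw [this]
    exact (isOpen_discrete _).preimage hρ
  have hmono : Monotone U := monotone_nat_of_le_succ fun k f hf => hsucc k _ hf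
  obtain ⟨k, hk⟩ := isCompact_univ.elim_directed_cover U hU
    (fun f _ => Set.mem_iUnion.2 (hex (run f))) hmono.directed_le
  exact ⟨k, fun r => hk (Set.mem_univ (⟨r.round, r.decreasing⟩ : X))⟩

/-! ### From protocols to chromatic maps and back -/

namespace DistTask

variable {n : ℕ} {V W : Type*} {T : DistTask n V W}

theorem faces_mono_of_subset {τ τ' : Finset V} (hτ : τ ∈ T.input.faces)
    (hτ' : τ' ∈ T.input.faces) (h : τ' ⊆ τ) :
    (T.Δ.toFun τ').faces ⊆ (T.Δ.toFun τ).faces := by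
  classical
  have hi : τ ∩ τ' = τ' := Finset.inter_eq_right.2 h
  have := T.Δ.inter τ hτ τ' hτ' (by
    convert (T.input.isRelLowerSet_faces hτ').1)
  intro ρ hρ
  refine (this ?_).1
  convert hρ

/-- Solvability asks for an output vertex of color `i` even when `i` never gets to decide; purity of
the output complex supplies one. -/
theorem exists_output_vertex (h : T.output.faces.Nonempty) (i : Fin (n + 1)) :
    ∃ v ∈ T.output.vertices, T.output.color v = i := by
  obtain ⟨σ, hσ⟩ := h
  obtain ⟨τ, hτ, -, hc⟩ := T.output_pure.2 σ hσ
  obtain ⟨v, hv, hi⟩ := ChromaticComplex.Facet.exists_vertex ⟨τ, hτ, hc⟩ i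
  exact ⟨v, T.output.singleton_mem_faces hτ hv, hi⟩

theorem finite_facet : Finite T.input.Facet :=
  (T.input_finite.subset (s := T.input.faces) (t := {ω | ω ∈ T.input.faces ∧ ω.card = n + 1}) fun _ h => h.1).to_subtype

/-- A wait-free protocol decides in all runs within a fixed number of rounds. -/
theorem Protocol.Solves.exists_decision_round {P : T.Protocol} (hP : P.Solves (waitFree n)) :
    ∃ k, ∀ r : IISRun n, ∀ ω : T.input.Facet, ∀ i ∈ r.active k,
      P.out k (r.view ω k i) ≠ none := by
  refine IISRun.exists_uniform
    (fun k r => ∀ ω : T.input.Facet, ∀ i ∈ r.active k, P.out k (r.view ω k i) ≠ none) ?_ ?_ ?_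
  -- A process that has decided by time `k` has `k₀ ≤ k`, so it keeps its decision at time `k + 1`.
  · intro k r h ω i hi
    have hik := r.active_succ_subset k hi
    obtain ⟨k₀, v, -, -, h1, h2⟩ := (hP r trivial ω).1 i
    have hk : k₀ ≤ k := by
      by_contra hk
      exact h ω i hik (h1 k (not_le.1 hk) (r.hasView_of_mem_active hik))
    simp [h2 (k + 1) (by omega) hi]
  · intro k r r' hrr h ω i hi
    rw [← IISRun.view_congr r r' ω fun m hm => hrr m hm.le]
    refine h ω i ?_
    cases k with
    | zero => simpa only [IISRun.active, IISRun.part, hrr 0 le_rfl] using hi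
    | succ k => simpa only [IISRun.active, hrr k k.le_succ] using hi
  · intro r
    have := finite_facet (T := T)
    -- For a fixed run, the maximum over the finitely many facets and processes is a common decision
    -- time.
    choose k₀ v _ _ _ h2 using fun ω : T.input.Facet => (hP r trivial ω).1
    obtain ⟨K, hK⟩ := (Set.finite_range fun p : T.input.Facet × Fin (n + 1) => k₀ p.1 p.2).bddAbove
    refine ⟨K, fun ω i hi => ?_⟩
    simp [h2 ω i K (hK ⟨(ω, i), rfl⟩) (r.hasView_of_mem_active hi)]

/-- The map sends a vertex to the decision at a view realizing it; the choice of view is harmless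
since equal vertices have equal views. A simplex of `Chr^k τ` comes from a single run, so the second
condition of solvability puts its image in `Δ` of a face of `τ`. -/
theorem SolvableIn.exists_chromaticMap (hT : T.SolvableIn (waitFree n)) :
    ∃ k : ℕ, ∃ η : ChromaticMap (T.input.chrIter k) T.output,
      ∀ τ ∈ T.input.faces, ∀ σ ∈ ((T.input.restrict τ).chrIter k).faces,
        η.image σ ∈ (T.Δ.toFun τ).faces := by
  classical
  obtain ⟨P, hP⟩ := hT
  obtain ⟨k, hk⟩ := hP.exists_decision_round
  have hcover : ∀ τ ∈ T.input.faces, ∀ σ ∈ ((T.input.restrict τ).chrIter k).faces,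
      ∃ (ω : T.input.Facet) (r : IISRun n), ω.colored r.part ⊆ τ ∧
        σ ⊆ (r.active k).image (r.chrVertex ω k) := by
    intro τ hτ σ hσ
    obtain ⟨ω, hω, hτω, hc⟩ := T.input_pure.2 τ hτ
    obtain ⟨r, hr, hσr⟩ := IISRun.exists_subset_image_chrVertex (⟨ω, hω, hc⟩ : T.input.Facet)
      hτω k hσ
    refine ⟨⟨ω, hω, hc⟩, r, fun v hv => ?_, hσr⟩
    obtain ⟨hv1, hv2⟩ := (ChromaticComplex.mem_colored _).1 hv
    obtain ⟨u, hu, huv⟩ := Finset.mem_image.1 (hr hv2)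
    -- Within `ω` a vertex is determined by its color, so participants colored by `τ` have their
    -- inputs in `τ`.
    exact T.input.color_injOn ω hω (hτω hu) hv1 huv ▸ hu
  have hvertex : ∀ x : (T.input.chrIter k).vertices, ∃ w : W,
      ∃ (ω : T.input.Facet) (r : IISRun n) (i : Fin (n + 1)), i ∈ r.active k ∧
        x.1 = r.chrVertex ω k i ∧ P.out k (r.view ω k i) = some w := by
    intro x
    obtain ⟨τ, hτ, hxτ⟩ := T.input.exists_carrier k x.2
    obtain ⟨ω, r, -, hx⟩ := hcover τ hτ _ hxτ
    obtain ⟨i, hi, hix⟩ := Finset.mem_image.1 (hx (Finset.mem_singleton_self _))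
    obtain ⟨w, hw⟩ := Option.ne_none_iff_exists'.1 (hk r ω i hi)
    exact ⟨w, ω, r, i, hi, hix.symm, hw⟩
  choose f hf using hvertex
  have himage : ∀ τ ∈ T.input.faces, ∀ σ ∈ ((T.input.restrict τ).chrIter k).faces,
      vertexImage f σ ∈ (T.Δ.toFun τ).faces := by
    intro τ hτ σ hσ
    obtain ⟨ω, r, hωr, hσr⟩ := hcover τ hτ σ hσ
    have hface := ChromaticComplex.colored_mem_faces ω (r.active_nonempty 0)
    obtain ⟨ρ, hρ, hsub⟩ := (hP r trivial ω).2 k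
    refine ((T.Δ.toFun τ).isRelLowerSet_faces (faces_mono_of_subset hτ hface hωr hρ)).2 ?_ ?_
    · intro w hw
      obtain ⟨x, hx, rfl⟩ := mem_vertexImage.1 hw
      obtain ⟨i, hi, hix⟩ := Finset.mem_image.1 (hσr hx)
      obtain ⟨ω', r', i', hi', hx', hw'⟩ := hf x
      refine Finset.mem_coe.1 (hsub ⟨i, r.hasView_of_mem_active hi, ?_⟩)
      rw [← hw', IISRun.view_eq_of_chrVertex_eq r r' ω ω' (hix.trans hx')]
    · have hσI := T.input.restrict_chrIter_faces_subset τ k hσ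
      obtain ⟨x, hx⟩ := ((T.input.chrIter k).isRelLowerSet_faces hσI).1
      exact ⟨_, mem_vertexImage.2
        ⟨⟨x, (T.input.chrIter k).singleton_mem_faces hσI hx⟩, hx, rfl⟩⟩
  refine ⟨k, ⟨f, fun σ hσ => ?_, fun x => ?_⟩, himage⟩
  -- Simpliciality is the carrier condition applied to a `τ` whose subdivision contains `σ`.
  · obtain ⟨τ, hτ, hστ⟩ := T.input.exists_carrier k hσ
    exact T.Δ.faces_subset τ hτ (himage τ hτ σ hστ)
  · obtain ⟨ω, r, i, hi, hx, hw⟩ := hf x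
    obtain ⟨k₀, v, -, hv, h1, h2⟩ := (hP r trivial ω).1 i
    have hik := r.hasView_of_mem_active hi
    have hk₀ : k₀ ≤ k := by
      by_contra hk'
      exact hk r ω i hi (h1 k (not_le.1 hk') hik)
    have : f x = v := Option.some.inj (hw.symm.trans (h2 k hk₀ hik))
    rw [this, hv, hx, IISRun.color_chrVertex]

theorem solvableIn_of_chromaticMap {k : ℕ} (η : ChromaticMap (T.input.chrIter k) T.output)
    (hη : ∀ τ ∈ T.input.faces, ∀ σ ∈ ((T.input.restrict τ).chrIter k).faces,
      η.image σ ∈ (T.Δ.toFun τ).faces) : T.SolvableIn (waitFree n) := by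
  classical
  have hmem : ∀ (r : IISRun n) (ω : T.input.Facet), ∀ i ∈ r.active k,
      r.chrVertex ω k i ∈ (T.input.chrIter k).vertices := fun r ω i hi =>
    (T.input.chrIter k).singleton_mem_faces (T.input.restrict_chrIter_faces_subset _ k
      (r.image_chrVertex_mem_faces ω k)) (Finset.mem_image_of_mem _ hi)
  have hη_mem : ∀ x, η.toFun x ∈ T.output.vertices := fun x =>
    T.output.singleton_mem_faces (η.map_faces _ x.2)
      (mem_vertexImage.2 ⟨x, Finset.mem_singleton_self _, rfl⟩)
  -- deciding only from level `k + 1` on ensures that nobody decides without participating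
  let Q : (j : ℕ) → IISView n V j → W → Prop := fun j w y => k + 1 ≤ j ∧
    ∃ (r : IISRun n) (ω : T.input.Facet) (i : Fin (n + 1)) (hi : i ∈ r.active k),
      i ∈ r.active j ∧ w = r.view ω j i ∧ y = η.toFun ⟨_, hmem r ω i hi⟩
  -- The output is well defined: equal `j`th views restrict to equal `k`th views, hence to the same
  -- vertex of `Chr^k`.
  have hQ : ∀ {j w y y'}, Q j w y → Q j w y' → y = y' := by
    rintro j w y y' ⟨hj, r, ω, i, hik, hij, rfl, rfl⟩ ⟨-, r', ω', i', hik', hij', h, rfl⟩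
    have := r.chrVertex_eq_of_view_eq r' ω ω' hik hik'
      (r.view_of_view_le r' ω ω' (by omega) hij h)
    simp only [this]
  let out : (j : ℕ) → IISView n V j → Option W := fun j w =>
    if h : ∃ y, Q j w y then some h.choose else none
  have hout : ∀ {j w y}, out j w = some y ↔ Q j w y := by
    intro j w y
    by_cases h : ∃ y, Q j w y
    · simp only [out, dif_pos h, Option.some.injEq]
      exact ⟨fun hy => hy ▸ h.choose_spec, fun hy => hQ h.choose_spec hy⟩
    · simp only [out, dif_neg h]
      exact ⟨fun h => by simp at h, fun hy => (h ⟨y, hy⟩).elim⟩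
  refine ⟨⟨out, ?_, ?_⟩, ?_⟩
  · intro j w hw
    obtain ⟨y, hy⟩ := Option.ne_none_iff_exists'.1 hw
    obtain ⟨-, r, ω, i, -, hij, hwi, -⟩ := hout.1 hy
    exact ⟨r, ω, i, r.hasView_of_mem_active hij, hwi⟩
  · intro j w y hy
    obtain ⟨-, r, ω, i, hi, -, -, rfl⟩ := hout.1 hy
    exact hη_mem _
  · intro r _ ω
    have hdec : ∀ {j i} (hi : i ∈ r.active k), k + 1 ≤ j → r.HasView i j →
        out j (r.view ω j i) = some (η.toFun ⟨_, hmem r ω i hi⟩) := by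
      intro j i hi hj hij
      refine hout.2 ⟨hj, r, ω, i, hi, ?_, rfl, rfl⟩
      obtain ⟨j, rfl⟩ := Nat.exists_eq_add_of_le' (show 1 ≤ j by omega)
      exact hij
    have hactive : ∀ {j i}, k + 1 ≤ j → r.HasView i j → i ∈ r.active k := by
      intro j i hj hij
      obtain ⟨j, rfl⟩ := Nat.exists_eq_add_of_le' (show 1 ≤ j by omega)
      exact r.active_antitone (show k ≤ j + 1 by omega) hij
    have hface := hη _ (ChromaticComplex.colored_mem_faces ω (r.active_nonempty 0)) _
      (r.image_chrVertex_mem_faces ω k)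
    refine ⟨fun i => ?_, fun j => ⟨_, hface, ?_⟩⟩
    · have hlt : ∀ j < k + 1, r.HasView i j → out j (r.view ω j i) = none := by
        intro j hj _
        refine Option.eq_none_iff_forall_ne_some.2 fun y hy => ?_
        have := (hout.1 hy).1
        omega
      by_cases hi : i ∈ r.active k
      · refine ⟨k + 1, η.toFun ⟨_, hmem r ω i hi⟩, hη_mem _, ?_, hlt, fun j hj => hdec hi hj⟩
        rw [η.color_eq, IISRun.color_chrVertex]
      -- A process inactive at level `k` has no view from level `k + 1` on, so any vertex of its
      -- color will do.
      · obtain ⟨v, hv, hvi⟩ := exists_output_vertex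
          ⟨_, T.Δ.faces_subset _ (ChromaticComplex.colored_mem_faces ω (r.active_nonempty 0))
            hface⟩ i
        exact ⟨k + 1, v, hv, hvi, hlt, fun j hj hij => (hi (hactive hj hij)).elim⟩
    · rintro v ⟨i, hij, hv⟩
      have hi := hactive (hout.1 hv).1 hij
      obtain rfl := Option.some.inj ((hdec hi (hout.1 hv).1 hij).symm.trans hv)
      exact Finset.mem_coe.2 (mem_vertexImage.2 ⟨_, Finset.mem_image_of_mem _ hi, rfl⟩)

end DistTask

/-- A task is wait-free solvable iff for some `k` there is a chromatic map
`η : Chr^k I → O` with `η(σ) ∈ Δ(τ)` for all simplices `τ` of `I` and `σ` of `Chr^k τ`. -/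
theorem corollary7p1 {n : ℕ} {V W : Type*} (T : DistTask n V W) :
    T.SolvableIn (waitFree n) ↔
      ∃ k : ℕ, ∃ η : ChromaticMap (T.input.chrIter k) T.output,
        ∀ τ ∈ T.input.faces, ∀ σ ∈ ((T.input.restrict τ).chrIter k).faces,
          η.image σ ∈ (T.Δ.toFun τ).faces :=
  ⟨fun h => h.exists_chromaticMap, fun ⟨_, η, hη⟩ => DistTask.solvableIn_of_chromaticMap η hη⟩
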